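/- Let $K$ be an infinite field, $\Gamma$ a finite quiver without double arrows (for each ordered pair of vertices $(a,b)$ there is at most one arrow $a\to b$), $I$ an admissible ideal of the path algebra $K\Gamma$, and $\Lambda=K\Gamma/I$. For paths, $qp$ means "$q$ after $p$"; a path $u$ is a right subpath of $p$ if $p=u'u$ for some path $u'$. A path $p$ is a mast of a uniserial left $\Lambda$-module $U$ if $U$ has composition length $\operatorname{length}(p)+1$ and $pU\neq 0$; $p$ is called a mast if it is a mast of some uniserial left $\Lambda$-module. A detour on $p$ is a pair $(\alpha,u)$ of an arrow $\alpha$ and a right subpath $u$ of $p$ such that $\alpha u$ is a path which is not a right subpath of $p$, while some right subpath of $p$ strictly longer than $u$ ends in the same vertex as $\alpha$. Let $(v_i(\alpha,u))_{i\in I(\alpha,u)}$ be the family of all right subpaths of $p$ that are strictly longer than $u$ and end in the same vertex as $\alpha$, and let $X_i(\alpha,u)$ be independent variables, one for each detour $(\alpha,u)$ on $p$ and each $i\in I(\alpha,u)$. Let $V_p$ be the affine variety of all families $(k_i(\alpha,u))$ of elements of $K$ such that the following representation of $\Gamma$ is a $\Lambda$-module, i.e. is annihilated by $I$: it has as $K$-basis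 the right subpaths $v$ of $p$, each placed at the vertex in which it ends, and for an arrow $\alpha$ starting where $v$ ends, $\alpha\cdot v=\alpha v$ if $\alpha v$ is a right subpath of $p$, $\alpha\cdot v=\sum_{i\in I(\alpha,v)}k_i(\alpha,v)\,v_i(\alpha,v)$ if $(\alpha,v)$ is a detour on $p$, and $\alpha\cdot v=0$ otherwise. Let $A_p$ be the coordinate ring of $V_p$, i.e. the polynomial ring $K[X_i(\alpha,u)]$ modulo the ideal of polynomials vanishing on $V_p$. A detour $(\alpha,u)$ is a halyard on $p$ if some $X_i(\alpha,u)$ has nonzero image in $A_p$. A variable $X_i(\alpha,u)$ of a halyard is slack if its image in $A_p$ is transcendental over $K$, and a halyard with at least one slack variable is called slack. **Theorem.** Let $p$ be a mast of positive length starting in the vertex $e$ and satisfying the following condition: (Suf, $p$) Whenever $(\alpha,u)$ is a slack halyard on $p$ and $X_r(\alpha,u)$ is a slack variable, there exists a right subpath $w_r(\alpha,u): e\to e$ of $p$ such that $v_r(\alpha,u)=\alpha u\,w_r(\alpha,u)$ in $K\Gamma$. Then there are only finitely many uniserial left $\Lambda$-modules with mast $p$, up to isomorphism. -/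

import Mathlib

universe u v k w

namespace Uniserial

open Quiver

/-! ### The path algebra of a finite quiver -/

section PathAlgebra

/-- A path of the quiver, together with its starting vertex and its end vertex. -/
abbrev TotalPath (V : Type u) [Quiver.{v} V] : Type (max u v) :=
  Σ a : V, Σ b : V, Path a b

/-- The underlying vector space of the path algebra `KΓ`: the `K`-vector space with basis the
set of all paths (including the paths of length zero) of the quiver `Γ` with vertex set `V`. -/
def PathAlgebra (K : Type k) (V : Type u) [Quiver.{v} V] [Field K] : Type (max u v k) :=
  TotalPath V →₀ K

variable (K : Type k) (V : Type u) [Quiver.{v} V] [Field K]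

noncomputable instance : AddCommGroup (PathAlgebra K V) :=
  inferInstanceAs (AddCommGroup (TotalPath V →₀ K))

noncomputable instance : Module K (PathAlgebra K V) :=
  inferInstanceAs (Module K (TotalPath V →₀ K))

variable {V}

/-- A path, regarded as an element of the path algebra. -/
noncomputable def ofPath {a b : V} (q : Path a b) : PathAlgebra K V :=
  (Finsupp.single (⟨a, b, q⟩ : TotalPath V) (1 : K) : TotalPath V →₀ K)

open Classical in
/-- The product `qp` of two paths, that is, `q` after `p`; it is zero if `q` does not start
where `p` ends. -/
noncomputable def pathMul (q p : TotalPath V) : PathAlgebra K V :=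
  if h : q.1 = p.2.1 then ofPath K (p.2.2.comp (q.2.2.cast h rfl)) else 0

variable (V)

/-- The bilinear extension of the multiplication of paths. -/
noncomputable def mulLin : PathAlgebra K V →ₗ[K] PathAlgebra K V →ₗ[K] PathAlgebra K V :=
  Finsupp.linearCombination K (M := PathAlgebra K V →ₗ[K] PathAlgebra K V)
    fun q : TotalPath V =>
      Finsupp.linearCombination K (M := PathAlgebra K V) fun p : TotalPath V => pathMul K q p

variable {V}

theorem mulLin_ofPath {a b c d : V} (q : Path c d) (p : Path a b) :
    mulLin K V (ofPath K q) (ofPath K p) = pathMul K ⟨c, d, q⟩ ⟨a, b, p⟩ := by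
  have h1 : mulLin K V (ofPath K q) =
      Finsupp.linearCombination K (M := PathAlgebra K V)
        fun p : TotalPath V => pathMul K ⟨c, d, q⟩ p := by
    unfold mulLin ofPath
    erw [Finsupp.linearCombination_single]
    exact one_smul _ _
  rw [h1]
  unfold ofPath
  erw [Finsupp.linearCombination_single]
  exact one_smul _ _

theorem pathMul_comp {a b c : V} (q : Path b c) (p : Path a b) :
    pathMul K ⟨b, c, q⟩ ⟨a, b, p⟩ = ofPath K (p.comp q) := by
  simp [pathMul]

theorem pathMul_zero {a b c d : V} (q : Path c d) (p : Path a b) (h : c ≠ b) :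
    pathMul K ⟨c, d, q⟩ ⟨a, b, p⟩ = 0 := by
  simp [pathMul, h]

theorem pathAlgebra_induction {P : PathAlgebra K V → Prop} (h0 : P 0)
    (hadd : ∀ f g, P f → P g → P (f + g)) (hsmul : ∀ (t : K) f, P f → P (t • f))
    (hpath : ∀ (a b : V) (q : Path a b), P (ofPath K q)) (f : PathAlgebra K V) : P f := by
  refine Finsupp.induction_linear (motive := P) (f : TotalPath V →₀ K) h0 hadd ?_
  rintro ⟨a, b, q⟩ t
  have h : (Finsupp.single (⟨a, b, q⟩ : TotalPath V) t : TotalPath V →₀ K) =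
      (t • (ofPath K q : PathAlgebra K V) : PathAlgebra K V) := by
    unfold ofPath
    exact (Finsupp.smul_single_one (⟨a, b, q⟩ : TotalPath V) t).symm
  rw [h]
  exact hsmul t _ (hpath a b q)

variable (V)

noncomputable instance : Mul (PathAlgebra K V) := ⟨fun f g => mulLin K V f g⟩

variable {V}

theorem mul_def (f g : PathAlgebra K V) : f * g = mulLin K V f g := rfl

theorem ofPath_mul {a b c d : V} (q : Path c d) (p : Path a b) :
    ofPath K q * ofPath K p = pathMul K ⟨c, d, q⟩ ⟨a, b, p⟩ :=
  mulLin_ofPath K q p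

theorem pathAlgebra_mul_assoc (f g h : PathAlgebra K V) : f * g * h = f * (g * h) := by
  simp only [mul_def]
  induction f using pathAlgebra_induction K with
  | h0 => simp
  | hadd f₁ f₂ h₁ h₂ => simp [h₁, h₂]
  | hsmul t f hf => simp [hf]
  | hpath a b r =>
    induction g using pathAlgebra_induction K with
    | h0 => simp
    | hadd f₁ f₂ h₁ h₂ => simp [h₁, h₂]
    | hsmul t f hf => simp [hf]
    | hpath c d q =>
      induction h using pathAlgebra_induction K with
      | h0 => simp
      | hadd f₁ f₂ h₁ h₂ => simp [h₁, h₂]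
      | hsmul t f hf => simp [hf]
      | hpath c' d' p =>
        by_cases h1 : a = d
        · subst h1
          by_cases h2 : c = d'
          · subst h2
            simp [mulLin_ofPath, pathMul_comp]
          · simp [mulLin_ofPath, pathMul_comp, pathMul_zero K _ _ h2]
        · by_cases h2 : c = d'
          · subst h2
            simp [mulLin_ofPath, pathMul_comp, pathMul_zero K _ _ h1]
          · simp [mulLin_ofPath, pathMul_zero K _ _ h1, pathMul_zero K _ _ h2]

variable (V) [Fintype V]

/-- The identity of `KΓ` is the sum of the paths of length zero. -/
noncomputable instance : One (PathAlgebra K V) := ⟨∑ a : V, ofPath K (Path.nil : Path a a)⟩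

variable {V}

theorem one_def : (1 : PathAlgebra K V) = ∑ a : V, ofPath K (Path.nil : Path a a) := rfl

theorem pathAlgebra_one_mul (f : PathAlgebra K V) : 1 * f = f := by
  simp only [mul_def]
  induction f using pathAlgebra_induction K with
  | h0 => simp
  | hadd f₁ f₂ h₁ h₂ => simp [h₁, h₂]
  | hsmul t f hf => simp [hf]
  | hpath a b r =>
    rw [one_def, map_sum, LinearMap.sum_apply, Finset.sum_eq_single b]
    · rw [mulLin_ofPath, pathMul_comp, Path.comp_nil]
    · intro c _ hc
      rw [mulLin_ofPath, pathMul_zero K _ _ hc]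
    · simp

theorem pathAlgebra_mul_one (f : PathAlgebra K V) : f * 1 = f := by
  simp only [mul_def]
  induction f using pathAlgebra_induction K with
  | h0 => simp
  | hadd f₁ f₂ h₁ h₂ => simp [h₁, h₂]
  | hsmul t f hf => simp [hf]
  | hpath a b r =>
    rw [one_def, map_sum, Finset.sum_eq_single a]
    · rw [mulLin_ofPath, pathMul_comp, Path.nil_comp]
    · intro c _ hc
      rw [mulLin_ofPath, pathMul_zero K _ _ (Ne.symm hc)]
    · simp

variable (V)

/-- The path algebra is a ring; the unit is available because the vertex set is finite. -/
noncomputable instance : Ring (PathAlgebra K V) :=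
  { (inferInstance : AddCommGroup (PathAlgebra K V)) with
    mul := (· * ·)
    one := 1
    left_distrib := fun f g h => map_add (mulLin K V f) g h
    right_distrib := fun f g h => by
      simp only [mul_def, map_add, LinearMap.add_apply]
    zero_mul := fun f => by simp only [mul_def, map_zero, LinearMap.zero_apply]
    mul_zero := fun f => map_zero (mulLin K V f)
    mul_assoc := pathAlgebra_mul_assoc K
    one_mul := pathAlgebra_one_mul K
    mul_one := pathAlgebra_mul_one K }

noncomputable instance : Algebra K (PathAlgebra K V) :=
  Algebra.ofModule
    (fun t f g => by simp only [mul_def, map_smul, LinearMap.smul_apply])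
    (fun t f g => by simp only [mul_def, map_smul])

/-- The `n`-th power of the ideal of `KΓ` generated by the arrows: the span of all paths of
length at least `n`. -/
noncomputable def arrowPow (n : ℕ) : Submodule K (PathAlgebra K V) :=
  Submodule.span K {f | ∃ (a b : V) (q : Path a b), n ≤ q.length ∧ f = ofPath K q}

variable {K V}

/-- An ideal `I` of `KΓ` is admissible if it contains all paths of length at least `m`, for some
`m`, and if it is contained in the square of the ideal generated by the arrows. -/
def IsAdmissible (I : Ideal (PathAlgebra K V)) : Prop :=
  (∃ m : ℕ, (arrowPow K V m : Set (PathAlgebra K V)) ⊆ I) ∧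
    (I : Set (PathAlgebra K V)) ⊆ arrowPow K V 2

end PathAlgebra

/-! ### Masts -/

section Mast

variable {K : Type k} {V : Type u} [Quiver.{v} V] [Field K] [Fintype V]
variable (I : Ideal (PathAlgebra K V)) [I.IsTwoSided]

/-- The path `p` is a mast of the left `KΓ/I`-module `U`, and `U` is uniserial: the submodules
of `U` form a chain, the composition length of `U` is one more than the length of `p`, and
`pU ≠ 0`. -/
def IsUniserialWithMast {a b : V} (p : Path a b) (U : Type w) [AddCommGroup U]
    [Module (PathAlgebra K V ⧸ I) U] : Prop :=
  (∀ N N' : Submodule (PathAlgebra K V ⧸ I) U, N ≤ N' ∨ N' ≤ N) ∧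
    Module.length (PathAlgebra K V ⧸ I) U = p.length + 1 ∧
    ∃ y : U, Ideal.Quotient.mk I (ofPath K p) • y ≠ 0

/-- The path `p` is a mast of some uniserial left `KΓ/I`-module. (Uniserial modules of finite
length are cyclic, so each of them is isomorphic to one in the universe of `KΓ`.) -/
def IsMast {a b : V} (p : Path a b) : Prop :=
  ∃ U : ModuleCat.{max u v k} (PathAlgebra K V ⧸ I), IsUniserialWithMast I p U

/-- The uniserial left `KΓ/I`-modules with mast `p`, in an arbitrary universe. -/
abbrev UniserialWithMast {a b : V} (p : Path a b) : Type (max u v k (w + 1)) :=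
  {U : ModuleCat.{w} (PathAlgebra K V ⧸ I) // IsUniserialWithMast I p U}

/-- The isomorphism relation on the uniserial modules with mast `p`. -/
def isoSetoid {a b : V} (p : Path a b) : Setoid (UniserialWithMast.{u, v, k, w} I p) where
  r U U' := Nonempty (U.1 ≃ₗ[PathAlgebra K V ⧸ I] U'.1)
  iseqv :=
    { refl := fun _ => ⟨LinearEquiv.refl _ _⟩
      symm := fun ⟨f⟩ => ⟨f.symm⟩
      trans := fun ⟨f⟩ ⟨g⟩ => ⟨f.trans g⟩ }

end Mast

/-! ### Detours and the variety of a path -/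

section Detour

variable {V : Type u} [Quiver.{v} V]

/-- `u` is a right subpath of `p`, that is, `p = u'u` (`u'` after `u`) for some path `u'`. -/
def IsRightSubpath {e b e' : V} (u : Path e b) (p : Path e e') : Prop :=
  ∃ u' : Path b e', p = u.comp u'

/-- `(α, u)` is a detour on `p`: `u` is a right subpath of `p`, the path `αu` is not a right
subpath of `p`, and some right subpath of `p` strictly longer than `u` ends where `α` ends. -/
def IsDetour {e e' b c : V} (p : Path e e') (α : b ⟶ c) (u : Path e b) : Prop :=
  IsRightSubpath u p ∧ ¬ IsRightSubpath (u.cons α) p ∧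
    ∃ v : Path e c, IsRightSubpath v p ∧ u.length < v.length

/-- The index set of the variables `X_i(α, u)`: the detours `(α, u)` on `p`, together with a
right subpath `v = v_i(α, u)` of `p` which is longer than `u` and ends where `α` ends. -/
structure DetourVar {e e' : V} (p : Path e e') : Type (max u v) where
  /-- the starting vertex of `α` -/
  b : V
  /-- the end vertex of `α` -/
  c : V
  /-- the arrow of the detour -/
  α : b ⟶ c
  /-- the right subpath of the detour -/
  u : Path e b
  /-- the right subpath `v_i(α, u)`, which serves as the index `i` -/
  v : Path e c
  detour : IsDetour p α u
  right : IsRightSubpath v p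
  longer : u.length < v.length

/-- The right subpaths of `p` that end in the vertex `c`. -/
abbrev RightSubpath {e e' : V} (p : Path e e') (c : V) : Type (max u v) :=
  {v : Path e c // IsRightSubpath v p}

instance {e e' : V} (p : Path e e') (c : V) : Finite (RightSubpath p c) := by
  refine Finite.of_injective
    (fun v : RightSubpath p c => (⟨v.1.length, ?_⟩ : Fin (p.length + 1))) ?_
  · obtain ⟨v', hv'⟩ := v.2
    have h := congrArg Path.length hv'
    rw [Path.length_comp] at h
    omega
  · intro v₁ v₂ h
    obtain ⟨w₁, h₁⟩ := v₁.2
    obtain ⟨w₂, h₂⟩ := v₂.2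
    have hl : v₁.1.length = v₂.1.length := by simpa using h
    exact Subtype.ext ((Path.comp_inj' hl).1 (h₁.symm.trans h₂)).1

noncomputable instance {e e' : V} (p : Path e e') (c : V) : Fintype (RightSubpath p c) :=
  Fintype.ofFinite _

variable (K : Type k) [Field K]

open Classical in
/-- The substitution equation for `αu`, where `u` is a right subpath of `p`: the path `αu` is
left alone if it is a right subpath of `p`; it is replaced by `∑ X_i(α, u) v_i(α, u)` if `(α, u)`
is a detour on `p`, and by zero otherwise. The value of `substCoeff K p α u v` is the coefficient
of the right subpath `v` in the outcome. -/
noncomputable def substCoeff {e e' b c : V} (p : Path e e') (α : b ⟶ c) (u : RightSubpath p b)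
    (v : RightSubpath p c) : MvPolynomial (DetourVar p) K :=
  if hα : IsRightSubpath (u.1.cons α) p then
    if v.1 = u.1.cons α then 1 else 0
  else if hv : u.1.length < v.1.length then
    MvPolynomial.X ⟨b, c, α, u.1, v.1, ⟨u.2, hα, v.1, v.2, hv⟩, v.2, hv⟩
  else 0

open Classical in
/-- Reduction of a path `q` by iterated substitution from the right: `q` is replaced by a
combination of right subpaths of `p` with coefficients in the polynomial ring in the variables
`X_i(α, u)`; paths that do not start in the starting vertex of `p` reduce to zero. The value of
`reduce K p q v` is the coefficient of `v`. -/
noncomputable def reduce {e e' a : V} (p : Path e e') :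
    {c : V} → Path a c → RightSubpath p c → MvPolynomial (DetourVar p) K
  | _, .nil => fun v => if v.1.length = 0 then 1 else 0
  | _, .cons (b := b) q α => fun v =>
      ∑ u : RightSubpath p b, reduce p q u * substCoeff K p α u v

open Classical in
/-- The linear extension of `reduce` to `KΓ`: the coefficient of the right subpath `v` of `p`
in the reduction of `f`. -/
noncomputable def reduction {e e' c : V} (p : Path e e') (v : RightSubpath p c) :
    PathAlgebra K V →ₗ[K] MvPolynomial (DetourVar p) K :=
  Finsupp.linearCombination K fun q : TotalPath V =>
    if h : q.2.1 = c then reduce K p (q.2.2.cast rfl h) v else 0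

variable {K} [Fintype V]

/-- The affine variety `V_p`: the set of common zeros in affine space over `K` of the
polynomials obtained from the elements of `I` by reduction. Its points are the families of
scalars `k_i(α, u)` for which the representation of the quiver with basis the right subpaths
`v` of `p`, and with `αu = ∑ k_i(α, u) v_i(α, u)` for each detour `(α, u)`, is a `KΓ/I`-module;
the map `Φ_p` sends the point to the class of that module. -/
noncomputable def mastVariety (I : Ideal (PathAlgebra K V)) {e e' : V} (p : Path e e') :
    Set (DetourVar p → K) :=
  MvPolynomial.zeroLocus K (Ideal.span
    {P | ∃ f ∈ I, ∃ (c : V) (v : RightSubpath p c), P = reduction K p v f})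

/-- The coordinate ring `A_p` of the variety `V_p`. -/
abbrev CoordRing (I : Ideal (PathAlgebra K V)) {e e' : V} (p : Path e e') :
    Type (max u v k) :=
  MvPolynomial (DetourVar p) K ⧸ MvPolynomial.vanishingIdeal K (mastVariety I p)

/-- The image of the variable `X_i(α, u)` in the coordinate ring `A_p`. -/
noncomputable def coordVar (I : Ideal (PathAlgebra K V)) {e e' : V} (p : Path e e')
    (i : DetourVar p) : CoordRing I p :=
  Ideal.Quotient.mk _ (MvPolynomial.X i)

/-- The detour `(α, u)` on `p` is a halyard: at least one of the variables `X_j(α, u)` has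
nonzero image in `A_p`. -/
def IsHalyard (I : Ideal (PathAlgebra K V)) {e e' b c : V} (p : Path e e') (α : b ⟶ c)
    (u : Path e b) : Prop :=
  ∃ (v : Path e c) (hd : IsDetour p α u) (hr : IsRightSubpath v p) (hl : u.length < v.length),
    coordVar I p ⟨b, c, α, u, v, hd, hr, hl⟩ ≠ 0

/-- `X_i(α, u)` is a slack variable: `(α, u)` is a halyard on `p`, and the image of `X_i(α, u)`
in `A_p` is transcendental over `K`. -/
def IsSlackVar (I : Ideal (PathAlgebra K V)) {e e' : V} (p : Path e e') (i : DetourVar p) :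
    Prop :=
  IsHalyard I p i.α i.u ∧ Transcendental K (coordVar I p i)

/-- The halyard `(α, u)` is slack: it has at least one slack variable. -/
def IsSlackHalyard (I : Ideal (PathAlgebra K V)) {e e' b c : V} (p : Path e e') (α : b ⟶ c)
    (u : Path e b) : Prop :=
  IsHalyard I p α u ∧
    ∃ (v : Path e c) (hd : IsDetour p α u) (hr : IsRightSubpath v p) (hl : u.length < v.length),
      IsSlackVar I p ⟨b, c, α, u, v, hd, hr, hl⟩

/-- Condition (Suf, `p`): whenever `(α, u)` is a slack halyard on `p` and `X_r(α, u)` is a slack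
variable, there is a right subpath `w : e → e` of `p` with `v_r(α, u) = αuw` in `KΓ`. -/
def Suf (I : Ideal (PathAlgebra K V)) {e e' : V} (p : Path e e') : Prop :=
  ∀ r : DetourVar p, IsSlackHalyard I p r.α r.u → IsSlackVar I p r →
    ∃ w : Path e e, IsRightSubpath w p ∧ r.v = (w.comp r.u).cons r.α

end Detour

end Uniserial

/-! Let `U` be uniserial with mast `p`, and let `J` be the arrow ideal. Since `pU ≠ 0`, `J` acts
nilpotently and `U` has length `|p| + 1`, the filtration `J ^ m U` is strictly decreasing for `m ≤
|p| + 1` and must be a composition series. Take a top element `x = e x` with `px ≠ 0`. The vectors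
`vx`, `v` a right subpath of `p`, then form a `K`-basis adapted to this filtration, and the arrows
act on it through a point `κ` of `V_p`. That point determines the annihilator of `x`, hence `U` up
to isomorphism (`IsTopElement.smul_eq_zero_iff`).

It remains to choose `x` so that only finitely many `κ` occur. A coordinate that is not slack is
algebraic in `A_p`, so its values on `V_p` are roots of one nonzero polynomial
(`finite_values_of_not_isSlackVar`). A slack coordinate belongs, by (Suf, `p`), to some `v = αuw`
with `w : e → e`. Replacing `x` by `x + t w x` adds `t` to this coordinate and disturbs only deeper
terms otherwise (`IsFrame.add_smul_mem`). The path `w` determines the variable (`Factors.unique`),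
so the slack coordinates can be made zero in order of increasing length of `w`
(`exists_isFrame_eq_zero`). -/

namespace Uniserial

open Quiver

/-! ### Chains of maximal length in a bounded order. -/

section Order

/-- In a bounded order of height `n`, a strictly decreasing chain of length `n` starting at `⊤`
ends at `⊥` and cannot be refined. -/
theorem eq_bot_and_saturated_of_height_top {α : Type*} [PartialOrder α] [BoundedOrder α] {n : ℕ}
    (h : Order.height (⊤ : α) = n) (f : ℕ → α) (h0 : f 0 = ⊤) (hf : ∀ i < n, f (i + 1) < f i) :
    f n = ⊥ ∧ ∀ i < n, ∀ P, f (i + 1) < P → P ≤ f i → P = f i := by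
  -- Counting steps down from `⊤` bounds the height of `f i` above by `n - i`; counting up from `f
  -- n` bounds it below by the same number. Any extra element would violate this.
  have upper : ∀ i ≤ n, Order.height (f i) + i ≤ n := by
    intro i
    induction i with
    | zero => intro _; simp [h0, h]
    | succ i ih =>
      intro hi
      refine le_trans ?_ (ih (by omega))
      have := Order.height_add_one_le (hf i (by omega))
      calc Order.height (f (i + 1)) + ((i + 1 : ℕ) : ℕ∞)
          = Order.height (f (i + 1)) + 1 + i := by push_cast; ring
        _ ≤ _ := by gcongr
  have lower : ∀ i ≤ n, (i : ℕ∞) ≤ Order.height (f (n - i)) := by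
    intro i
    induction i with
    | zero => intro _; simp
    | succ i ih =>
      intro hi
      have h1 := Order.height_add_one_le (hf (n - (i + 1)) (by omega))
      rw [show n - (i + 1) + 1 = n - i by omega] at h1
      refine le_trans ?_ h1
      push_cast
      gcongr
      exact ih (by omega)
  refine ⟨?_, ?_⟩
  · by_contra hne
    have h1 := Order.height_add_one_le (bot_lt_iff_ne_bot.2 hne)
    have h2 := upper n le_rfl
    have h3 : (1 : ℕ∞) + n ≤ n := le_trans (by gcongr; exact le_trans (by simp) h1) h2
    have h4 : 1 + n ≤ n := by exact_mod_cast h3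
    omega
  · intro i hi P h1 h2
    by_contra hne
    have h3 := Order.height_add_one_le h1
    have h4 := Order.height_add_one_le (lt_of_le_of_ne h2 hne)
    have h5 := lower (n - (i + 1)) (by omega)
    rw [show n - (n - (i + 1)) = i + 1 by omega] at h5
    have h6 := upper i hi.le
    have h7 : ((n - (i + 1) : ℕ) : ℕ∞) + 1 + 1 + i ≤ n :=
      le_trans (by gcongr; exact le_trans (by gcongr; exact le_trans (by gcongr) h3) h4) h6
    have h8 : (n - (i + 1)) + 1 + 1 + i ≤ n := by exact_mod_cast h7
    omega

end Order

/-! ### Right subpaths of a path: totally ordered and determined by their length. -/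

section Paths

variable {V : Type u} [Quiver.{v} V]

theorem exists_comp_of_comp_eq_comp {a b c d : V} (s : Path a b) (t : Path a c) (s' : Path b d)
    (t' : Path c d) (h : s.comp s' = t.comp t') (hl : s.length ≤ t.length) :
    ∃ r : Path b c, t = s.comp r := by
  induction t' with
  | nil => exact ⟨s', h.symm⟩
  | cons t' β ih =>
    cases s' with
    | nil =>
      have := congrArg Path.length h
      simp [Path.length_comp] at this
      omega
    | cons s' γ =>
      simp only [Path.comp_cons] at h
      obtain rfl := Path.obj_eq_of_cons_eq_cons h
      exact ih s' (eq_of_heq (Path.heq_of_cons_eq_cons h))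

theorem IsRightSubpath.of_length_le {e e' b c : V} {p : Path e e'} {s : Path e b} {t : Path e c}
    (hs : IsRightSubpath s p) (ht : IsRightSubpath t p) (hl : s.length ≤ t.length) :
    IsRightSubpath s t := by
  obtain ⟨s', hs⟩ := hs
  obtain ⟨t', ht⟩ := ht
  exact exists_comp_of_comp_eq_comp s t s' t' (hs.symm.trans ht) hl

theorem IsRightSubpath.trans {e e' b c : V} {p : Path e e'} {s : Path e b} {t : Path e c}
    (hs : IsRightSubpath s t) (ht : IsRightSubpath t p) : IsRightSubpath s p := by
  obtain ⟨s', rfl⟩ := hs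
  obtain ⟨t', rfl⟩ := ht
  exact ⟨s'.comp t', Path.comp_assoc _ _ _⟩

theorem IsRightSubpath.of_cons {e e' b c : V} {p : Path e e'} {s : Path e b} {α : b ⟶ c}
    (h : IsRightSubpath (s.cons α) p) : IsRightSubpath s p :=
  IsRightSubpath.trans ⟨α.toPath, rfl⟩ h

theorem IsRightSubpath.length_le {e e' b : V} {p : Path e e'} {s : Path e b}
    (h : IsRightSubpath s p) : s.length ≤ p.length := by
  obtain ⟨s', rfl⟩ := h
  simp [Path.length_comp]

theorem IsRightSubpath.eq_of_length_eq {e e' b : V} {p : Path e e'} {s t : Path e b}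
    (hs : IsRightSubpath s p) (ht : IsRightSubpath t p) (hl : s.length = t.length) : s = t := by
  obtain ⟨s', hs⟩ := hs
  obtain ⟨t', ht⟩ := ht
  exact ((Path.comp_inj' hl).1 (hs.symm.trans ht)).1

theorem IsRightSubpath.obj_eq_of_length_eq {e e' b c : V} {p : Path e e'} {s : Path e b}
    {t : Path e c} (hs : IsRightSubpath s p) (ht : IsRightSubpath t p)
    (hl : s.length = t.length) : b = c := by
  obtain ⟨r, rfl⟩ := hs.of_length_le ht hl.le
  refine Path.eq_of_length_zero r ?_
  rw [Path.length_comp] at hl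
  omega

theorem isRightSubpath_self {e e' : V} (p : Path e e') : IsRightSubpath p p := ⟨Path.nil, rfl⟩

theorem exists_isRightSubpath_length_eq {e e' : V} (p : Path e e') {n : ℕ} (hn : n ≤ p.length) :
    ∃ (c : V) (s : Path e c), IsRightSubpath s p ∧ s.length = n := by
  induction p with
  | nil => exact ⟨_, Path.nil, isRightSubpath_self _, (Nat.le_zero.1 hn).symm⟩
  | cons q α ih =>
    rcases Nat.lt_or_ge q.length n with h | h
    · refine ⟨_, q.cons α, isRightSubpath_self _, ?_⟩
      rw [Path.length_cons] at hn ⊢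
      omega
    · obtain ⟨c, s, hs, hl⟩ := ih h
      exact ⟨c, s, hs.trans ⟨α.toPath, rfl⟩, hl⟩

/-- In a quiver without double arrows, an arrow continuing a right subpath `s` of `p` along a
right subpath of `p` of the next length is the next arrow of `p`. -/
theorem IsRightSubpath.cons_of_length_eq (hΓ : ∀ a b : V, Subsingleton (a ⟶ b)) {e e' b c : V}
    {p : Path e e'} {s : Path e b} {t : Path e c} (α : b ⟶ c) (hs : IsRightSubpath s p)
    (ht : IsRightSubpath t p) (hl : t.length = s.length + 1) : IsRightSubpath (s.cons α) p := by
  cases t with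
  | nil => simp at hl
  | cons t γ =>
    have hl' : s.length = t.length := by simpa using hl.symm
    obtain rfl := hs.obj_eq_of_length_eq ht.of_cons hl'
    obtain rfl := hs.eq_of_length_eq ht.of_cons hl'
    rwa [(hΓ _ _).elim α γ]

end Paths

/-! ### The radical filtration of a module. -/

section Radical

variable {K : Type k} {V : Type u} [Quiver.{v} V] [Field K]

theorem ofPath_mul_ofPath {a b c : V} (q : Path b c) (r : Path a b) :
    ofPath K q * ofPath K r = ofPath K (r.comp q) := by
  rw [ofPath_mul, pathMul_comp]

theorem ofPath_mul_ofPath_of_ne {a b c d : V} (q : Path c d) (r : Path a b) (h : c ≠ b) :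
    ofPath K q * ofPath K r = 0 := by
  rw [ofPath_mul, pathMul_zero K _ _ h]

variable [Fintype V] {U : Type w} [AddCommGroup U] [Module (PathAlgebra K V) U]

theorem ofPath_smul_ofPath_smul {a b c : V} (q : Path b c) (r : Path a b) (y : U) :
    ofPath K q • ofPath K r • y = ofPath K (r.comp q) • y := by
  rw [smul_smul, ofPath_mul_ofPath]

theorem ofPath_smul_ofPath_smul_of_ne {a b c d : V} (q : Path c d) (r : Path a b) (h : c ≠ b)
    (y : U) : ofPath K q • ofPath K r • y = 0 := by
  rw [smul_smul, ofPath_mul_ofPath_of_ne _ _ h, zero_smul]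

variable (K V U) in
/-- The submodule `J ^ m U`, where `J` is the ideal of the path algebra generated by the arrows. -/
noncomputable def radPow (m : ℕ) : Submodule (PathAlgebra K V) U :=
  Submodule.span _ {y | ∃ (a b : V) (q : Path a b) (z : U), m ≤ q.length ∧ y = ofPath K q • z}

theorem ofPath_smul_mem_radPow' {a b : V} (q : Path a b) (z : U) {m : ℕ} (h : m ≤ q.length) :
    ofPath K q • z ∈ radPow K V U m :=
  Submodule.subset_span ⟨a, b, q, z, h, rfl⟩

theorem radPow_zero : radPow K V U 0 = ⊤ := by
  rw [eq_top_iff]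
  intro y _
  rw [← one_smul (PathAlgebra K V) y, one_def, Finset.sum_smul]
  exact Submodule.sum_mem _ fun a _ => ofPath_smul_mem_radPow' _ _ (Nat.zero_le _)

theorem radPow_antitone : Antitone (radPow K V U) := by
  intro m n h
  refine Submodule.span_mono ?_
  rintro y ⟨a, b, q, z, hq, rfl⟩
  exact ⟨a, b, q, z, h.trans hq, rfl⟩

variable [Module K U] [IsScalarTower K (PathAlgebra K V) U]

theorem smul_mem_radPow (t : K) {m : ℕ} {y : U} (h : y ∈ radPow K V U m) :
    t • y ∈ radPow K V U m :=
  Submodule.smul_of_tower_mem _ t h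

theorem ofPath_smul_smul {a b : V} (q : Path a b) (t : K) (y : U) :
    ofPath K q • t • y = t • ofPath K q • y := by
  rw [← algebraMap_smul (PathAlgebra K V) t y, smul_smul, ← Algebra.commutes, ← smul_smul,
    algebraMap_smul]

theorem ofPath_smul_mem_radPow {a b : V} (q : Path a b) {m : ℕ} {y : U}
    (h : y ∈ radPow K V U m) : ofPath K q • y ∈ radPow K V U (q.length + m) := by
  -- The span is taken over the path algebra, whose elements do not commute with `q`; the extra
  -- factor `f` lets the induction absorb them.
  suffices H : ∀ f : PathAlgebra K V, ofPath K q • f • y ∈ radPow K V U (q.length + m) by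
    simpa using H 1
  induction h using Submodule.span_induction with
  | mem y hy =>
    obtain ⟨c, d, r, z, hr, rfl⟩ := hy
    intro f
    induction f using pathAlgebra_induction K with
    | h0 => simp
    | hadd f g hf hg => rw [add_smul, smul_add]; exact add_mem hf hg
    | hsmul t f hf =>
      rw [smul_assoc, ofPath_smul_smul]
      exact smul_mem_radPow t hf
    | hpath a' b' s =>
      by_cases h1 : a' = d
      · subst h1
        rw [ofPath_smul_ofPath_smul]
        by_cases h2 : a = b'
        · subst h2
          rw [ofPath_smul_ofPath_smul]
          refine ofPath_smul_mem_radPow' _ _ ?_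
          simp only [Path.length_comp]
          omega
        · rw [ofPath_smul_ofPath_smul_of_ne _ _ h2]
          exact zero_mem _
      · rw [ofPath_smul_ofPath_smul_of_ne _ _ h1, smul_zero]
        exact zero_mem _
  | zero => simp
  | add y z _ _ hy hz =>
    intro f
    rw [smul_add, smul_add]
    exact add_mem (hy f) (hz f)
  | smul g y _ hy =>
    intro f
    rw [smul_smul f g]
    exact hy _

/-- Once the filtration is stationary at one step it is stationary for ever, since each further step
only applies one more arrow. With nilpotency this forces strict descent, in place of Nakayama's
lemma. -/
theorem radPow_succ_le_of_le {i : ℕ} (h : radPow K V U i ≤ radPow K V U (i + 1)) (j : ℕ) :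
    radPow K V U i ≤ radPow K V U (i + j) := by
  have step : ∀ n, radPow K V U n ≤ radPow K V U (n + 1) →
      radPow K V U (n + 1) ≤ radPow K V U (n + 1 + 1) := by
    intro n hn
    refine Submodule.span_le.2 ?_
    rintro y ⟨a, b, q, z, hq, rfl⟩
    cases q with
    | nil => simp at hq
    | cons q α =>
      have h1 : ofPath K q • z ∈ radPow K V U n :=
        ofPath_smul_mem_radPow' _ _ (by simpa using hq)
      have h2 := ofPath_smul_mem_radPow α.toPath (hn h1)
      rw [ofPath_smul_ofPath_smul] at h2
      rw [Path.length_toPath, Nat.add_comm] at h2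
      exact h2
  have all : ∀ j, radPow K V U (i + j) ≤ radPow K V U (i + j + 1) := by
    intro j
    induction j with
    | zero => exact h
    | succ j ih => exact step _ ih
  induction j with
  | zero => exact le_rfl
  | succ j ih => exact ih.trans (all j)

variable (K V U) in
/-- The first `n + 1` terms of the radical filtration of `U` form a composition series. -/
def RadSaturated (n : ℕ) : Prop :=
  radPow K V U n = ⊥ ∧ ∀ i < n, ∀ N, radPow K V U (i + 1) < N → N ≤ radPow K V U i →
    N = radPow K V U i

theorem radSaturated_of_length {n m : ℕ} (hlen : Module.length (PathAlgebra K V) U = n + 1)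
    (hm : radPow K V U m = ⊥) (hn : radPow K V U n ≠ ⊥) : RadSaturated K V U (n + 1) := by
  rw [Module.length_eq_height] at hlen
  refine eq_bot_and_saturated_of_height_top (by exact_mod_cast hlen) _ radPow_zero ?_
  intro i hi
  refine lt_of_le_not_ge (radPow_antitone (Nat.le_succ i)) fun hle => hn ?_
  rw [eq_bot_iff]
  calc radPow K V U n ≤ radPow K V U i := radPow_antitone (by omega)
    _ ≤ radPow K V U (i + m) := radPow_succ_le_of_le hle m
    _ ≤ radPow K V U m := radPow_antitone (by omega)
    _ = ⊥ := hm

end Radical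

/-! ### Top elements and the basis of right subpaths. -/

section Top

variable {K : Type k} {V : Type u} [Quiver.{v} V] [Field K] [Fintype V]
variable {U : Type w} [AddCommGroup U] [Module (PathAlgebra K V) U]
variable {e e' : V} {p : Path e e'}

variable (K p) in
/-- `x` is a top element of `U` witnessing that `p` does not annihilate `U`. -/
def IsTopElement (x : U) : Prop :=
  ofPath K (Path.nil : Path e e) • x = x ∧ ofPath K p • x ≠ 0

/-- Write `p = v'v`. If `vx` were deeper than the length of `v`, then `px = v'vx` would lie in `J ^
(|p| + 1) U = 0`. -/
theorem IsTopElement.notMem_radPow {x : U} (hx : IsTopElement K p x) [Module K U]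
    [IsScalarTower K (PathAlgebra K V) U]
    (hU : RadSaturated K V U (p.length + 1)) {c : V} {v : Path e c} (hv : IsRightSubpath v p)
    {m : ℕ} (hm : v.length < m) :
    ofPath K v • x ∉ radPow K V U m := by
  intro h
  obtain ⟨v', hv'⟩ := hv
  have h1 := ofPath_smul_mem_radPow v' h
  have hl := congrArg Path.length hv'
  rw [Path.length_comp] at hl
  rw [ofPath_smul_ofPath_smul, ← hv'] at h1
  have h2 := radPow_antitone (show p.length + 1 ≤ v'.length + m by omega) h1
  rw [hU.1] at h2
  exact hx.2 (by simpa using h2)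

variable [Module K U] [IsScalarTower K (PathAlgebra K V) U]

/-- Descending induction on `m`. For `v` of length `m`, `vx` lies in `J ^ m U` but not in the next
term, so by saturation it generates `J ^ m U` modulo that term. Paths of positive length push `vx`
into the next term, so only its scalar multiples are needed. -/
theorem IsTopElement.radPow_le {x : U} (hx : IsTopElement K p x)
    (hU : RadSaturated K V U (p.length + 1)) (m : ℕ) {y : U} (hy : y ∈ radPow K V U m) :
    y ∈ Submodule.span K {y : U | ∃ (c : V) (v : Path e c), IsRightSubpath v p ∧
      m ≤ v.length ∧ y = ofPath K v • x} := by
  rcases Nat.lt_or_ge p.length m with h | h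
  · have h1 := radPow_antitone (show p.length + 1 ≤ m from h) hy
    rw [hU.1, Submodule.mem_bot] at h1
    rw [h1]
    exact zero_mem _
  · induction hd : p.length + 1 - m generalizing m y with
    | zero => omega
    | succ d ih =>
      obtain ⟨c, v, hv, hl⟩ := exists_isRightSubpath_length_eq p h
      have mono : ∀ z ∈ radPow K V U (m + 1), z ∈ Submodule.span K {y : U | ∃ (c : V)
          (v : Path e c), IsRightSubpath v p ∧ m ≤ v.length ∧ y = ofPath K v • x} := by
        intro z hz
        rcases Nat.lt_or_ge p.length (m + 1) with h' | h'
        · have h1 := radPow_antitone (show p.length + 1 ≤ m + 1 from h') hz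
          rw [hU.1, Submodule.mem_bot] at h1
          rw [h1]
          exact zero_mem _
        · refine Submodule.span_mono ?_ (ih (m + 1) hz h' (by omega))
          rintro _ ⟨c, v, h1, h2, rfl⟩
          exact ⟨c, v, h1, by omega, rfl⟩
      have hvm : ofPath K v • x ∈ radPow K V U m := ofPath_smul_mem_radPow' _ _ hl.ge
      have hN := hU.2 m (by omega)
        (radPow K V U (m + 1) ⊔ Submodule.span (PathAlgebra K V) {ofPath K v • x}) ?_ ?_
      · rw [← hN, Submodule.mem_sup] at hy
        obtain ⟨z, hz, z', hz', rfl⟩ := hy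
        refine add_mem (mono z hz) ?_
        obtain ⟨f, rfl⟩ := Submodule.mem_span_singleton.1 hz'
        clear hz'
        induction f using pathAlgebra_induction K with
        | h0 => simp
        | hadd f g hf hg => rw [add_smul]; exact add_mem hf hg
        | hsmul t f hf => rw [smul_assoc]; exact Submodule.smul_mem _ t hf
        | hpath a b q =>
          by_cases hac : a = c
          · subst hac
            cases q with
            | nil =>
              rw [ofPath_smul_ofPath_smul, Path.comp_nil]
              exact Submodule.subset_span ⟨_, v, hv, hl.ge, rfl⟩
            | cons q α =>
              refine mono _ ?_
              rw [ofPath_smul_ofPath_smul]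
              refine ofPath_smul_mem_radPow' _ _ ?_
              rw [Path.length_comp, Path.length_cons]
              omega
          · rw [ofPath_smul_ofPath_smul_of_ne _ _ hac]
            exact zero_mem _
      · refine lt_of_le_not_ge le_sup_left fun hle => ?_
        exact hx.notMem_radPow hU hv (show v.length < m + 1 by omega)
          (hle (Submodule.mem_sup_right (Submodule.mem_span_singleton_self _)))
      · refine sup_le (radPow_antitone (Nat.le_succ m)) ?_
        rwa [Submodule.span_singleton_le_iff_mem]

/-- Linear independence, refined by depth: a shortest `v` with nonzero coefficient would put `vx`
too deep in the filtration, because no other right subpath ending at `c` has the same length. -/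
theorem IsTopElement.coeff_eq_zero {x : U} (hx : IsTopElement K p x)
    (hU : RadSaturated K V U (p.length + 1)) {c : V} (a : RightSubpath p c → K) {m : ℕ}
    (h : ∑ v, a v • ofPath K v.1 • x ∈ radPow K V U m) (v : RightSubpath p c)
    (hv : v.1.length < m) : a v = 0 := by
  induction hn : v.1.length using Nat.strong_induction_on generalizing v with
  | _ n ih =>
    by_contra hne
    have hmem : a v • ofPath K v.1 • x ∈ radPow K V U (n + 1) := by
      classical
      rw [← Finset.add_sum_erase _ _ (Finset.mem_univ v)] at h
      refine (Submodule.add_mem_iff_left _ (Submodule.sum_mem _ fun s hs => ?_)).1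
        (radPow_antitone (show n + 1 ≤ m by omega) h)
      rcases lt_trichotomy s.1.length n with hlt | heq | hgt
      · rw [ih _ hlt s (by omega) rfl, zero_smul]
        exact zero_mem _
      · exact absurd (Subtype.ext (s.2.eq_of_length_eq v.2 (heq.trans hn.symm)))
          (Finset.ne_of_mem_erase hs)
      · exact smul_mem_radPow _ (ofPath_smul_mem_radPow' _ _ hgt)
    have h2 := smul_mem_radPow (a v)⁻¹ hmem
    rw [smul_smul, inv_mul_cancel₀ hne, one_smul] at h2
    exact hx.notMem_radPow hU v.2 (show v.1.length < n + 1 by omega) h2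

theorem IsTopElement.span_eq_top {x : U} (hx : IsTopElement K p x)
    (hU : RadSaturated K V U (p.length + 1)) :
    Submodule.span (PathAlgebra K V) {x} = ⊤ := by
  rw [eq_top_iff]
  intro y _
  have hy : y ∈ radPow K V U 0 := by rw [radPow_zero]; trivial
  have h := hx.radPow_le hU 0 hy
  refine (Submodule.span_le (p := (Submodule.span (PathAlgebra K V) {x}).restrictScalars K)).2
    ?_ h
  rintro _ ⟨c, v, _, _, rfl⟩
  exact Submodule.smul_mem _ _ (Submodule.mem_span_singleton_self x)

theorem IsTopElement.add_smul {x : U} (hx : IsTopElement K p x)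
    (hU : RadSaturated K V U (p.length + 1)) (t : K) {w : Path e e} (hw : 0 < w.length) :
    IsTopElement K p (x + t • ofPath K w • x) := by
  refine ⟨?_, fun h => ?_⟩
  · rw [smul_add, hx.1, ofPath_smul_smul, ofPath_smul_ofPath_smul, Path.comp_nil]
  · rw [smul_add, ofPath_smul_smul, ofPath_smul_ofPath_smul] at h
    have h1 : ofPath K (w.comp p) • x ∈ radPow K V U (p.length + 1) :=
      ofPath_smul_mem_radPow' _ _ (by rw [Path.length_comp]; omega)
    rw [hU.1, Submodule.mem_bot] at h1
    rw [h1, smul_zero, add_zero] at h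
    exact hx.2 h

theorem IsTopElement.exists_coeff {x : U} (hx : IsTopElement K p x)
    (hU : RadSaturated K V U (p.length + 1)) {m : ℕ} {y : U} (hy : y ∈ radPow K V U m) (c : V) :
    ∃ a : RightSubpath p c → K, (∀ v, v.1.length < m → a v = 0) ∧
      ofPath K (Path.nil : Path c c) • y = ∑ v, a v • ofPath K v.1 • x := by
  classical
  have h := hx.radPow_le hU m hy
  clear hy
  induction h using Submodule.span_induction with
  | mem y hy =>
    obtain ⟨d, v, hv, hm, rfl⟩ := hy
    by_cases hd : c = d
    · subst hd
      refine ⟨Pi.single ⟨v, hv⟩ 1, fun s hs => ?_, ?_⟩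
      · refine Pi.single_eq_of_ne ?_ _
        rintro rfl
        simp only at hs
        omega
      · rw [ofPath_smul_ofPath_smul, Path.comp_nil, Finset.sum_eq_single ⟨v, hv⟩]
        · simp
        · intro s _ hs
          rw [Pi.single_eq_of_ne hs, zero_smul]
        · simp
    · exact ⟨0, by simp, by simp [ofPath_smul_ofPath_smul_of_ne _ _ hd]⟩
  | zero => exact ⟨0, by simp, by simp⟩
  | add y z _ _ hy hz =>
    obtain ⟨a, ha, hy⟩ := hy
    obtain ⟨b, hb, hz⟩ := hz
    refine ⟨a + b, fun v hv => by simp [ha v hv, hb v hv], ?_⟩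
    simp [smul_add, hy, hz, _root_.add_smul, Finset.sum_add_distrib]
  | smul t y _ hy =>
    obtain ⟨a, ha, hy⟩ := hy
    refine ⟨t • a, fun v hv => by simp [ha v hv], ?_⟩
    simp [ofPath_smul_smul, hy, Finset.smul_sum, smul_smul]

end Top

/-! ### Coordinates of a module with a chosen top element. -/

section Frame

variable {K : Type k} {V : Type u} [Quiver.{v} V] [Field K]
variable {e e' : V} {p : Path e e'}

theorem aeval_substCoeff_of_not {b c : V} {α : b ⟶ c} {u : RightSubpath p b}
    (h : ¬ IsRightSubpath (u.1.cons α) p) (κ : DetourVar p → K) (v : RightSubpath p c)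
    (hv : u.1.length < v.1.length) :
    MvPolynomial.aeval κ (substCoeff K p α u v) =
      κ ⟨b, c, α, u.1, v.1, ⟨u.2, h, v.1, v.2, hv⟩, v.2, hv⟩ := by
  simp [substCoeff, h, hv]

theorem aeval_substCoeff_of_not_of_le {b c : V} {α : b ⟶ c} {u : RightSubpath p b}
    (h : ¬ IsRightSubpath (u.1.cons α) p) (κ : DetourVar p → K) (v : RightSubpath p c)
    (hv : v.1.length ≤ u.1.length) :
    MvPolynomial.aeval κ (substCoeff K p α u v) = 0 := by
  simp [substCoeff, h, not_lt.2 hv]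

variable [Fintype V]
variable {U : Type w} [AddCommGroup U] [Module (PathAlgebra K V) U] [Module K U]

/-- The scalars `κ` describe the action of the arrows on the basis `v x` of `U`, where `v` runs
through the right subpaths of `p`. -/
def IsFrame (x : U) (κ : DetourVar p → K) : Prop :=
  ∀ ⦃b c : V⦄ (α : b ⟶ c) (u : RightSubpath p b), ofPath K (u.1.cons α) • x =
    ∑ v : RightSubpath p c, MvPolynomial.aeval κ (substCoeff K p α u v) • ofPath K v.1 • x

variable [IsScalarTower K (PathAlgebra K V) U]

theorem IsTopElement.exists_isFrame {x : U} (hx : IsTopElement K p x)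
    (hU : RadSaturated K V U (p.length + 1)) : ∃ κ : DetourVar p → K, IsFrame x κ := by
  classical
  have key : ∀ (b c : V) (α : b ⟶ c) (u : RightSubpath p b), ∃ a : RightSubpath p c → K,
      (∀ v, v.1.length < u.1.length + 1 → a v = 0) ∧
      ofPath K (u.1.cons α) • x = ∑ v, a v • ofPath K v.1 • x := by
    intro b c α u
    obtain ⟨a, ha, h⟩ := hx.exists_coeff hU
      (ofPath_smul_mem_radPow' (u.1.cons α) x (Path.length_cons _ _ _ _ _).ge) c
    rw [ofPath_smul_ofPath_smul, Path.comp_nil] at h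
    exact ⟨a, ha, h⟩
  choose a ha hsum using key
  -- Recording only the `v` longer than `u` loses nothing: `αux` lies in `J ^ (|u| + 1) U`, so its
  -- other coefficients vanish.
  refine ⟨fun i => a i.b i.c i.α ⟨i.u, i.detour.1⟩ ⟨i.v, i.right⟩, fun b c α u => ?_⟩
  by_cases hα : IsRightSubpath (u.1.cons α) p
  · rw [Finset.sum_eq_single ⟨_, hα⟩]
    · simp [substCoeff, hα]
    · intro v _ hv
      have : v.1 ≠ u.1.cons α := fun h => hv (Subtype.ext h)
      simp [substCoeff, hα, this]
    · simp
  · rw [hsum]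
    refine Finset.sum_congr rfl fun v _ => ?_
    rcases Nat.lt_or_ge u.1.length v.1.length with h | h
    · rw [aeval_substCoeff_of_not hα _ _ h]
    · rw [aeval_substCoeff_of_not_of_le hα _ _ h, ha _ _ _ _ _ (by omega)]

/-- The recursion defining `reduce` mirrors applying the arrows of `q` to `x` one at a time and
expanding in the vectors `vx` after each. -/
theorem IsFrame.ofPath_smul {x : U} {κ : DetourVar p → K} (hκ : IsFrame x κ)
    (hx : ofPath K (Path.nil : Path e e) • x = x) {a c : V} (q : Path a c) :
    ofPath K q • x =
      ∑ v : RightSubpath p c, MvPolynomial.aeval κ (reduce K p q v) • ofPath K v.1 • x := by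
  induction q with
  | nil =>
    by_cases h : e = a
    · subst h
      rw [Finset.sum_eq_single ⟨Path.nil, p, (Path.nil_comp p).symm⟩]
      · simp [reduce]
      · intro v _ hv
        have : v.1.length ≠ 0 := fun h => hv (Subtype.ext (Path.eq_nil_of_length_zero _ h))
        simp [reduce, this]
      · simp
    · rw [← hx, ofPath_smul_ofPath_smul_of_ne _ _ (Ne.symm h)]
      refine (Finset.sum_eq_zero fun v _ => ?_).symm
      have : v.1.length ≠ 0 := fun h' => h (Path.eq_of_length_zero _ h')
      simp [reduce, this]
  | cons q α ih =>
    have h1 : ofPath K (q.cons α) • x = ofPath K α.toPath • ofPath K q • x := by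
      rw [ofPath_smul_ofPath_smul]
      rfl
    have h2 : ∀ u : RightSubpath p _, ofPath K α.toPath • ofPath K u.1 • x =
        ofPath K (u.1.cons α) • x := fun u => by
      rw [ofPath_smul_ofPath_smul]
      rfl
    rw [h1, ih, Finset.smul_sum]
    simp only [ofPath_smul_smul, h2, hκ α, reduce, map_sum, map_mul, Finset.sum_smul,
      Finset.smul_sum, smul_smul]
    exact Finset.sum_comm

theorem IsFrame.nil_smul_smul {x : U} {κ : DetourVar p → K} (hκ : IsFrame x κ)
    (hx : ofPath K (Path.nil : Path e e) • x = x) (f : PathAlgebra K V) (c : V) :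
    ofPath K (Path.nil : Path c c) • f • x =
      ∑ v : RightSubpath p c, MvPolynomial.aeval κ (reduction K p v f) • ofPath K v.1 • x := by
  classical
  induction f using pathAlgebra_induction K with
  | h0 => simp
  | hadd f g hf hg => simp [_root_.add_smul, smul_add, hf, hg, Finset.sum_add_distrib]
  | hsmul t f hf => simp [smul_assoc, ofPath_smul_smul, hf, Finset.smul_sum, mul_smul]
  | hpath a b q =>
    have hred : ∀ v : RightSubpath p c, reduction K p v (ofPath K q) =
        if h : b = c then reduce K p (q.cast rfl h) v else 0 := by
      intro v
      unfold reduction ofPath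
      erw [Finsupp.linearCombination_single, one_smul]
    by_cases h : b = c
    · subst h
      rw [ofPath_smul_ofPath_smul, Path.comp_nil, hκ.ofPath_smul hx]
      simp [hred]
    · rw [ofPath_smul_ofPath_smul_of_ne _ _ (Ne.symm h)]
      simp [hred, h]

/-- The right-hand side depends on `κ` alone, so modules with equal coordinates have generators with
equal annihilators. -/
theorem IsTopElement.smul_eq_zero_iff {x : U} (hx : IsTopElement K p x)
    (hU : RadSaturated K V U (p.length + 1)) {κ : DetourVar p → K} (hκ : IsFrame x κ)
    (f : PathAlgebra K V) :
    f • x = 0 ↔ ∀ (c : V) (v : RightSubpath p c),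
      MvPolynomial.aeval κ (reduction K p v f) = 0 := by
  constructor
  · intro h c v
    refine hx.coeff_eq_zero hU (fun v => MvPolynomial.aeval κ (reduction K p v f))
      (m := p.length + 1) ?_ v (Nat.lt_succ_of_le v.2.length_le)
    rw [← hκ.nil_smul_smul hx.1, h, smul_zero]
    exact zero_mem _
  · intro h
    rw [← one_smul (PathAlgebra K V) (f • x), one_def, Finset.sum_smul]
    refine Finset.sum_eq_zero fun c _ => ?_
    rw [hκ.nil_smul_smul hx.1]
    exact Finset.sum_eq_zero fun v _ => by rw [h, zero_smul]

theorem IsTopElement.mem_mastVariety {x : U} (hx : IsTopElement K p x)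
    (hU : RadSaturated K V U (p.length + 1)) {κ : DetourVar p → K} (hκ : IsFrame x κ)
    {I : Ideal (PathAlgebra K V)} (hI : ∀ f ∈ I, ∀ y : U, f • y = 0) :
    κ ∈ mastVariety I p := by
  rw [mastVariety, MvPolynomial.zeroLocus_span]
  rintro P ⟨f, hf, c, v, rfl⟩
  exact (hx.smul_eq_zero_iff hU hκ f).1 (hI f hf x) c v

end Frame

/-! ### Killing slack coordinates by changing the top element. -/

section Normalisation

variable {K : Type k} {V : Type u} [Quiver.{v} V] [Field K]
variable {e e' : V} {p : Path e e'}

/-- The variable `r` comes from a factorization `v = α u w` with `w : e → e` a right subpath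
of `p`. -/
def Factors (r : DetourVar p) (w : Path e e) : Prop :=
  IsRightSubpath w p ∧ r.v = (w.comp r.u).cons r.α

theorem Factors.length_eq {r : DetourVar p} {w : Path e e} (h : Factors r w) :
    r.v.length = r.u.length + 1 + w.length := by
  rw [h.2, Path.length_cons, Path.length_comp]
  omega

/-- If `r.u` were shorter than `s.u`, then `αuw` for `r` would be a right subpath of `s.u` after
`w`. Cancelling `w` puts `r.α` after `r.u` on `p`, which a detour forbids. -/
theorem Factors.length_u_le {r s : DetourVar p} {w : Path e e} (hr : Factors r w)
    (hs : Factors s w) : s.u.length ≤ r.u.length := by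
  by_contra hlt
  rw [not_le] at hlt
  have h1 : IsRightSubpath ((w.comp r.u).cons r.α) p := hr.2 ▸ r.right
  have h2 : IsRightSubpath ((w.comp s.u).cons s.α) p := hs.2 ▸ s.right
  obtain ⟨t, ht⟩ := h1.of_length_le h2.of_cons (by
    rw [Path.length_cons, Path.length_comp, Path.length_comp]
    omega)
  rw [← Path.comp_cons, Path.comp_assoc] at ht
  have hu : s.u = (r.u.cons r.α).comp t := Path.comp_injective_right w ht
  exact r.detour.2.1 (IsRightSubpath.trans ⟨t, hu⟩ s.detour.1)

theorem Factors.unique (hΓ : ∀ a b : V, Subsingleton (a ⟶ b)) {r s : DetourVar p}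
    {w : Path e e} (hr : Factors r w) (hs : Factors s w) : r = s := by
  have hu := le_antisymm (hs.length_u_le hr) (hr.length_u_le hs)
  have hv : r.v.length = s.v.length := by rw [hr.length_eq, hs.length_eq, hu]
  clear hr hs
  obtain ⟨b, c, α, u, v, hd, hvp, hlt⟩ := r
  obtain ⟨b', c', α', u', v', hd', hvp', hlt'⟩ := s
  obtain rfl : b = b' := hd.1.obj_eq_of_length_eq hd'.1 hu
  obtain rfl : c = c' := hvp.obj_eq_of_length_eq hvp' hv
  obtain rfl : u = u' := hd.1.eq_of_length_eq hd'.1 hu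
  obtain rfl : v = v' := hvp.eq_of_length_eq hvp' hv
  obtain rfl := (hΓ _ _).elim α α'
  rfl

variable [Fintype V]
variable {U : Type w} [AddCommGroup U] [Module (PathAlgebra K V) U] [Module K U]
  [IsScalarTower K (PathAlgebra K V) U]

/-- The effect on the coordinates of replacing the top element `x` by `x + t w x`, up to the
order given by the length of `w`. -/
theorem IsFrame.add_smul_mem (hΓ : ∀ a b : V, Subsingleton (a ⟶ b)) {x : U}
    {κ κ' : DetourVar p → K} {t : K} {w : Path e e} (hκ : IsFrame x κ)
    (hκ' : IsFrame (x + t • ofPath K w • x) κ') {b c : V} (β : b ⟶ c) (u : RightSubpath p b)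
    (hβ : ¬ IsRightSubpath (u.1.cons β) p) :
    (∑ v : RightSubpath p c, (MvPolynomial.aeval κ' (substCoeff K p β u v) -
      MvPolynomial.aeval κ (substCoeff K p β u v)) • ofPath K v.1 • x) -
      t • ofPath K ((w.comp u.1).cons β) • x ∈ radPow K V U (u.1.length + w.length + 2) := by
  have h := hκ' β u
  have hb : ofPath K (u.1.cons β) • ofPath K w • x = ofPath K ((w.comp u.1).cons β) • x := by
    rw [ofPath_smul_ofPath_smul, Path.comp_cons]
  simp only [smul_add, ofPath_smul_smul, hb] at h
  rw [hκ β u, Finset.sum_add_distrib] at h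
  have h' : (∑ v : RightSubpath p c, (MvPolynomial.aeval κ' (substCoeff K p β u v) -
      MvPolynomial.aeval κ (substCoeff K p β u v)) • ofPath K v.1 • x) -
      t • ofPath K ((w.comp u.1).cons β) • x =
      - ∑ v : RightSubpath p c, MvPolynomial.aeval κ' (substCoeff K p β u v) •
        t • ofPath K v.1 • ofPath K w • x := by
    simp only [sub_smul, Finset.sum_sub_distrib]
    rw [sub_sub, sub_eq_iff_eq_add, h]
    abel
  rw [h']
  refine neg_mem (Submodule.sum_mem _ fun v _ => ?_)
  rcases Nat.lt_or_ge u.1.length v.1.length with hl | hl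
  · refine smul_mem_radPow _ (smul_mem_radPow _ ?_)
    rw [ofPath_smul_ofPath_smul]
    refine ofPath_smul_mem_radPow' _ _ ?_
    -- Without double arrows, a right subpath of this length ending at `c` would be `βu` itself. So
    -- `v` exceeds `u` by at least two, which gives the `+ 2` in the bound.
    have hne : v.1.length ≠ u.1.length + 1 := fun hl' =>
      hβ (u.2.cons_of_length_eq hΓ β v.2 hl')
    rw [Path.length_comp]
    omega
  · rw [aeval_substCoeff_of_not_of_le hβ _ _ hl, zero_smul]
    exact zero_mem _

/-- If every variable in `S` factors through a right subpath `e → e` of `p`, then a suitable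
choice of the top element makes the coordinates in `S` vanish. -/
theorem exists_isFrame_eq_zero (hΓ : ∀ a b : V, Subsingleton (a ⟶ b))
    (hU : RadSaturated K V U (p.length + 1)) {x₀ : U} (hx₀ : IsTopElement K p x₀)
    (S : Set (DetourVar p)) (hS : ∀ r ∈ S, ∃ w, Factors r w) (d : ℕ) :
    ∃ (x : U) (κ : DetourVar p → K), IsTopElement K p x ∧ IsFrame x κ ∧
      ∀ r ∈ S, r.v.length < r.u.length + 1 + d → κ r = 0 := by
  classical
  induction d with
  | zero =>
    obtain ⟨κ, hκ⟩ := hx₀.exists_isFrame hU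
    exact ⟨x₀, κ, hx₀, hκ, fun r _ hr => absurd hr (by have := r.longer; omega)⟩
  | succ d ih =>
    obtain ⟨x, κ, hx, hκ, hz⟩ := ih
    by_cases hex : ∃ r ∈ S, r.v.length = r.u.length + 1 + d
    · obtain ⟨r, hrS, hrd⟩ := hex
      obtain ⟨w, hw⟩ := hS r hrS
      have hwd : w.length = d := by have := hw.length_eq; omega
      -- A trivial `w` would make `αu` a right subpath of `p`.
      have hw0 : 0 < w.length := by
        rcases Nat.eq_zero_or_pos w.length with h | h
        · have h1 := hw.2
          rw [Path.eq_nil_of_length_zero w h, Path.nil_comp] at h1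
          exact absurd (h1 ▸ r.right) r.detour.2.1
        · exact h
      -- The coordinate at `r` changes by `t`, so `t = -κ r` annihilates it.
      have hx' := hx.add_smul hU (-κ r) hw0
      obtain ⟨κ', hκ'⟩ := hx'.exists_isFrame hU
      refine ⟨_, κ', hx', hκ', fun s hsS hs => ?_⟩
      have hmem := hκ.add_smul_mem hΓ hκ' s.α ⟨s.u, s.detour.1⟩ s.detour.2.1
      have hval : ∀ κ : DetourVar p → K, MvPolynomial.aeval κ
          (substCoeff K p s.α ⟨s.u, s.detour.1⟩ ⟨s.v, s.right⟩) = κ s := fun κ =>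
        aeval_substCoeff_of_not s.detour.2.1 κ ⟨s.v, s.right⟩ s.longer
      rcases Nat.lt_or_ge s.v.length (s.u.length + 1 + d) with hlt | hge
      -- Coordinates killed earlier survive: the correction term `t αuw x` itself lies deeper than
      -- `s.v`.
      · have hmem' := add_mem (radPow_antitone
          (show s.u.length + 1 + d ≤ s.u.length + w.length + 2 by omega) hmem)
          (smul_mem_radPow (-κ r) (ofPath_smul_mem_radPow' ((w.comp s.u).cons s.α) x
            (show s.u.length + 1 + d ≤ _ by
              rw [Path.length_cons, Path.length_comp]; omega)))
        rw [sub_add_cancel] at hmem'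
        have h0 := hx.coeff_eq_zero hU _ hmem' ⟨s.v, s.right⟩ hlt
        simp only [hval] at h0
        rw [sub_eq_zero.1 h0, hz s hsS hlt]
      -- At the current depth, `s` factors through a right subpath `e → e` of the same length as
      -- `w`, hence through `w`; uniqueness leaves only `s = r`.
      · have hsw : Factors s w := by
          obtain ⟨w', hw'⟩ := hS s hsS
          have : w' = w := hw'.1.eq_of_length_eq hw.1 (by have := hw'.length_eq; omega)
          exact this ▸ hw'
        obtain rfl := hw.unique hΓ hsw
        have hsum : ofPath K ((w.comp r.u).cons r.α) • x =
            ∑ v : RightSubpath p r.c, (if v = ⟨r.v, r.right⟩ then (1 : K) else 0) •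
              ofPath K v.1 • x := by
          rw [Finset.sum_eq_single ⟨r.v, r.right⟩]
          · simp [← hw.2]
          · intro v _ hv
            simp [hv]
          · simp
        rw [hsum, Finset.smul_sum, ← Finset.sum_sub_distrib] at hmem
        simp only [smul_smul, ← sub_smul] at hmem
        have h0 := hx.coeff_eq_zero hU _ hmem ⟨r.v, r.right⟩
          (show r.v.length < r.u.length + w.length + 2 by omega)
        simp only [hval, if_true] at h0
        linear_combination h0
    · refine ⟨x, κ, hx, hκ, fun r hr hl => hz r hr ?_⟩
      have : r.v.length ≠ r.u.length + 1 + d := fun h => hex ⟨r, hr, h⟩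
      omega

end Normalisation

/-! ### Finitely many variables, and finitely many values of those that are not slack. -/

section Finiteness

variable {K : Type k} {V : Type u} [Quiver.{v} V] [Field K] [Fintype V]

theorem finite_detourVar (hΓ : ∀ a b : V, Subsingleton (a ⟶ b)) {e e' : V} (p : Path e e') :
    Finite (DetourVar p) := by
  refine Finite.of_injective (β := Σ b : V, Σ c : V, RightSubpath p b × RightSubpath p c)
    (fun i => ⟨i.b, i.c, ⟨i.u, i.detour.1⟩, ⟨i.v, i.right⟩⟩) ?_
  rintro ⟨b, c, α, u, v, hd, hv, hl⟩ ⟨b', c', α', u', v', hd', hv', hl'⟩ h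
  simp only [Sigma.mk.injEq] at h
  obtain ⟨rfl, h⟩ := h
  simp only [heq_eq_eq, Sigma.mk.injEq] at h
  obtain ⟨rfl, h⟩ := h
  simp only [heq_eq_eq, Prod.mk.injEq, Subtype.mk.injEq] at h
  obtain ⟨rfl, rfl⟩ := h
  obtain rfl := (hΓ _ _).elim α α'
  rfl

theorem isSlackVar_of_transcendental {I : Ideal (PathAlgebra K V)} {e e' : V} {p : Path e e'}
    {i : DetourVar p} (h : Transcendental K (coordVar I p i)) : IsSlackVar I p i := by
  refine ⟨⟨i.v, i.detour, i.right, i.longer, fun h0 => h ?_⟩, h⟩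
  rw [show coordVar I p i = 0 from h0]
  exact isAlgebraic_zero

/-- A variable that is not slack takes only finitely many values on `V_p`. -/
theorem finite_values_of_not_isSlackVar {I : Ideal (PathAlgebra K V)} {e e' : V}
    {p : Path e e'} {i : DetourVar p} (h : ¬ IsSlackVar I p i) :
    {t : K | ∃ κ ∈ mastVariety I p, κ i = t}.Finite := by
  have halg : IsAlgebraic K (coordVar I p i) := by
    by_contra hc
    exact h (isSlackVar_of_transcendental hc)
  obtain ⟨P, hP, h0⟩ := halg
  refine (Polynomial.finite_setOfPred_isRoot hP).subset ?_
  rintro _ ⟨κ, hκ, rfl⟩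
  have h1 : Polynomial.aeval (coordVar I p i) P =
      Ideal.Quotient.mkₐ K (MvPolynomial.vanishingIdeal K (mastVariety I p))
        (Polynomial.aeval (MvPolynomial.X i) P) :=
    Polynomial.aeval_algHom_apply (Ideal.Quotient.mkₐ K
      (MvPolynomial.vanishingIdeal K (mastVariety I p))) _ _
  rw [h1, Ideal.Quotient.mkₐ_eq_mk, Ideal.Quotient.eq_zero_iff_mem,
    MvPolynomial.mem_vanishingIdeal_iff] at h0
  have h2 := h0 κ hκ
  rw [← Polynomial.aeval_algHom_apply, MvPolynomial.aeval_X] at h2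
  simpa [Polynomial.IsRoot, Polynomial.coe_aeval_eq_eval] using h2

end Finiteness

/-! ### Passing between modules over the path algebra and over its quotient. -/

section Quotient

variable {K : Type k} {V : Type u} [Quiver.{v} V] [Field K] [Fintype V]

theorem length_eq_of_surjective_ringHom {R A M : Type*} [Ring R] [Ring A] [AddCommGroup M]
    [Module R M] [Module A M] (φ : A →+* R) (hφ : Function.Surjective φ)
    (h : ∀ (f : A) (y : M), f • y = φ f • y) : Module.length A M = Module.length R M := by
  let E : Submodule R M ≃o Submodule A M :=
    { toFun := fun N => { N.toAddSubmonoid with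
        smul_mem' := fun f y hy => by rw [h]; exact N.smul_mem _ hy }
      invFun := fun N => { N.toAddSubmonoid with
        smul_mem' := fun f y hy => by
          obtain ⟨g, rfl⟩ := hφ f
          rw [← h]
          exact N.smul_mem _ hy }
      left_inv := fun _ => rfl
      right_inv := fun _ => rfl
      map_rel_iff' := Iff.rfl }
  rw [← WithBot.coe_inj, Module.coe_length, Module.coe_length]
  exact (Order.krullDim_eq_of_orderIso E).symm

theorem nonempty_linearEquiv_of_generators {R M N : Type*} [Ring R] [AddCommGroup M]
    [AddCommGroup N] [Module R M] [Module R N] {x : M} {y : N}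
    (hx : Submodule.span R {x} = ⊤) (hy : Submodule.span R {y} = ⊤)
    (h : ∀ f : R, f • x = 0 ↔ f • y = 0) : Nonempty (M ≃ₗ[R] N) := by
  have hx' : Function.Surjective (LinearMap.toSpanSingleton R M x) := by
    rw [← LinearMap.range_eq_top, LinearMap.range_toSpanSingleton, hx]
  have hy' : Function.Surjective (LinearMap.toSpanSingleton R N y) := by
    rw [← LinearMap.range_eq_top, LinearMap.range_toSpanSingleton, hy]
  have hk : LinearMap.ker (LinearMap.toSpanSingleton R M x) =
      LinearMap.ker (LinearMap.toSpanSingleton R N y) := by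
    ext f
    simpa using h f
  exact ⟨(LinearMap.quotKerEquivOfSurjective _ hx').symm.trans
    ((Submodule.quotEquivOfEq _ _ hk).trans (LinearMap.quotKerEquivOfSurjective _ hy'))⟩

/-- A uniserial module with mast `p` has a generator whose annihilator is described by a point of
`V_p` with vanishing slack coordinates. -/
theorem exists_generator (hΓ : ∀ a b : V, Subsingleton (a ⟶ b))
    {I : Ideal (PathAlgebra K V)} [I.IsTwoSided] (hI : IsAdmissible I) {e e' : V}
    {p : Path e e'} (hsuf : Suf I p) {U : Type w} [AddCommGroup U]
    [Module (PathAlgebra K V ⧸ I) U] (hU : IsUniserialWithMast I p U) :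
    ∃ κ ∈ mastVariety I p, (∀ r, IsSlackVar I p r → κ r = 0) ∧ ∃ x : U,
      Submodule.span (PathAlgebra K V ⧸ I) {x} = ⊤ ∧ ∀ f, Ideal.Quotient.mk I f • x = 0 ↔
        ∀ (c : V) (v : RightSubpath p c), MvPolynomial.aeval κ (reduction K p v f) = 0 := by
  let : Module (PathAlgebra K V) U := Module.compHom U (Ideal.Quotient.mk I)
  let : Module K U := Module.compHom U (algebraMap K (PathAlgebra K V))
  have hmk : ∀ (f : PathAlgebra K V) (y : U), f • y = Ideal.Quotient.mk I f • y :=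
    fun _ _ => rfl
  have : IsScalarTower K (PathAlgebra K V) U := ⟨fun t f y => by
    rw [Algebra.smul_def, mul_smul]
    rfl⟩
  have hIU : ∀ f ∈ I, ∀ y : U, f • y = 0 := fun f hf y => by
    rw [hmk, Ideal.Quotient.eq_zero_iff_mem.2 hf, zero_smul]
  obtain ⟨-, hlen, y, hy⟩ := hU
  obtain ⟨⟨m, hm⟩, -⟩ := hI
  have hnil : radPow K V U m = ⊥ := by
    rw [eq_bot_iff, radPow, Submodule.span_le]
    rintro _ ⟨a, b, q, z, hq, rfl⟩
    exact hIU _ (hm (Submodule.subset_span ⟨a, b, q, hq, rfl⟩)) z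
  have hsat : RadSaturated K V U (p.length + 1) := by
    refine radSaturated_of_length (m := m) ?_ hnil fun h => hy ?_
    · rw [length_eq_of_surjective_ringHom (Ideal.Quotient.mk I) Ideal.Quotient.mk_surjective hmk,
        hlen]
    · have h1 : ofPath K p • y ∈ radPow K V U p.length := ofPath_smul_mem_radPow' _ _ le_rfl
      rw [h] at h1
      exact (Submodule.mem_bot _).1 h1
  have htop : IsTopElement K p (ofPath K (Path.nil : Path e e) • y) := by
    refine ⟨?_, ?_⟩
    · rw [ofPath_smul_ofPath_smul, Path.comp_nil]
    · rw [ofPath_smul_ofPath_smul, Path.nil_comp]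
      exact hy
  -- With `d = |p| + 1` the length restriction covers every slack variable, as `r.v` is no longer
  -- than `p`.
  obtain ⟨x, κ, hx, hκ, hz⟩ := exists_isFrame_eq_zero hΓ hsat htop {r | IsSlackVar I p r}
    (fun r hr => hsuf r ⟨hr.1, r.v, r.detour, r.right, r.longer, hr⟩ hr) (p.length + 1)
  refine ⟨κ, hx.mem_mastVariety hsat hκ hIU, fun r hr => hz r hr ?_, x, ?_, fun f => ?_⟩
  · have := r.right.length_le
    omega
  · rw [eq_top_iff]
    intro z _
    have hz : z ∈ Submodule.span (PathAlgebra K V) {x} := by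
      rw [hx.span_eq_top hsat]
      trivial
    obtain ⟨f, rfl⟩ := Submodule.mem_span_singleton.1 hz
    exact Submodule.mem_span_singleton.2 ⟨Ideal.Quotient.mk I f, rfl⟩
  · exact hx.smul_eq_zero_iff hsat hκ f

end Quotient

end Uniserial

/-! ### The finiteness theorem. -/

theorem theorem5p7 {K : Type k} [Field K] [Infinite K] {V : Type u} [Fintype V] [Quiver.{v} V]
    (hΓ : ∀ a b : V, Subsingleton (a ⟶ b))
    (I : Ideal (Uniserial.PathAlgebra K V)) [I.IsTwoSided] (hI : Uniserial.IsAdmissible I)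
    {e e' : V} (p : Quiver.Path e e') (hp : 0 < p.length) (hmast : Uniserial.IsMast I p)
    (hsuf : Uniserial.Suf I p) :
    Finite (Quotient (Uniserial.isoSetoid.{u, v, k, w} I p)) := by
  have := Uniserial.finite_detourVar hΓ p
  -- A finite product of finite sets: `{0}` suffices for each slack coordinate, and the values on
  -- `V_p` for each of the others.
  have hfin : {κ : Uniserial.DetourVar p → K | ∀ r,
      κ r ∈ {t : K | (Uniserial.IsSlackVar I p r → t = 0) ∧
        ∃ κ' ∈ Uniserial.mastVariety I p, κ' r = t}}.Finite := by
    refine Set.Finite.pi' fun r => ?_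
    by_cases hr : Uniserial.IsSlackVar I p r
    · exact (Set.finite_singleton 0).subset fun t ht => ht.1 hr
    · exact (Uniserial.finite_values_of_not_isSlackVar hr).subset fun t ht => ht.2
  choose κ hmem hslack x hspan hann using
    fun U : Uniserial.UniserialWithMast.{u, v, k, w} I p =>
      Uniserial.exists_generator hΓ hI hsuf U.2
  -- The normalised point of a chosen representative maps isomorphism classes injectively into this
  -- finite set.
  refine Set.finite_univ_iff.1 (Set.Finite.of_finite_image (f := fun q => κ q.out)
    (hfin.subset ?_) ?_)
  · rintro _ ⟨q, -, rfl⟩ r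
    exact ⟨hslack q.out r, κ q.out, hmem q.out, rfl⟩
  intro q _ q' _ hκ
  replace hκ : κ q.out = κ q'.out := hκ
  rw [← q.out_eq, ← q'.out_eq]
  refine Quotient.sound (Uniserial.nonempty_linearEquiv_of_generators (hspan q.out)
    (hspan q'.out) fun f => ?_)
  obtain ⟨f, rfl⟩ := Ideal.Quotient.mk_surjective f
  rw [hann, hann, hκ]
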